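/- A matching $M$ in a graph $G$ is called connected if all edges of $M$ lie in the same connected component of $G$ (the empty matching is connected). Let $\alpha'_*(G)$ denote the largest number of edges in a connected matching of $G$. Theorem. Let $x_1,x_2,x_3$ be integers with $1\le x_2\le x_1$ and $1\le x_3\le x_1$, let $N=2x_1+x_2+x_3-2$, and let $G=K_N$ be the complete graph on $N$ vertices. Let $E(G)=E_1\cup E_2\cup E_3$ be a partition of the edges of $G$ (some of the $E_i$ may be empty), and for $i=1,2,3$ let $G_i$ be the graph with vertex set $V(G)$ and edge set $E_i$. Then for some $i\in\{1,2,3\}$ we have $\alpha'_*(G_i)\ge x_i$. -/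

import Mathlib

/-- A matching `M` in `G` is connected if all its edges lie in the same component of `G`
(the empty matching is connected). The vertices of a matching are exactly the ends of its edges. -/
def SimpleGraph.IsConnectedMatching {V : Type*} (G : SimpleGraph V) (M : G.Subgraph) : Prop :=
  M.IsMatching ∧ ∀ u ∈ M.verts, ∀ v ∈ M.verts, G.Reachable u v

/-- The size (number of edges) of a largest connected matching in `G`. -/
noncomputable def SimpleGraph.connectedMatchingNumber {V : Type*} (G : SimpleGraph V) : ℕ∞ :=
  ⨆ M : {M : G.Subgraph // G.IsConnectedMatching M}, M.1.edgeSet.encard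

/-!
Let `a i` be one less than the bound for colour `i`, and `m = x₁ - 1`, so that `a i ≤ m`. The claim
is that a vertex set `U`, all of whose pairs are edges of some colour, has at most
`a 0 + a 1 + a 2 + m + 1` elements if, for every `i`, the matchings in each component of colour `i`
have at most `a i` edges. It is proved by induction on the size of `U`, in
`card_le_of_connectedMatchingsLE`.

The tool from matching theory is `exists_barrier`, a form of the Gallai-Edmonds theorem: a graph
whose matchings have at most `a` edges contains a set `S` such that deleting `S` lowers this bound
to `a - S.card` and leaves components with at most `2 * (a - S.card) + 1` vertices. It follows from
Gallai's lemma (`mem_ends_of_linked`). Deleting barriers of the components that matter costs as many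
vertices as it lowers the bound, so it allows induction (`card_le_of_delete`).

Any two vertices lie in a common component of some colour, which leaves three configurations.

* Some colour connects `U`. Delete its barrier; if the barrier is empty, then `U` itself has at most
  `2 * a i + 1` vertices.
* There is a component `P l` in each colour `l` such that every vertex lies in at least two of the
  three (`exists_central_classes`). Take barriers `S l` of the `P l`. If deleting all three leaves
  no vertex outside any of the `P l`, induction applies. Otherwise some `w` outside `P k` survives.
  Either deleting the two barriers of the other colours `i` and `j` leaves only vertices in the
  intersection of `P i` and `P j`, and induction applies again, or what is left is the union of the
  parts of `w` in the colours `i` and `j`; the differences of these parts are completely joined in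
  colour `k`, so one of them has at most `a k` vertices (`card_le_of_two_parts`).
* Any two vertices share either all three components or exactly one
  (`card_le_of_linked_in_one_or_all`). The vertices then fall into at most four classes, with edges
  of a single colour between any two of them. Induction, applied to the largest class with suitably
  lowered bounds, yields a matching there that extends to the remaining vertices.
-/

/-! ### Matchings and connectivity inside a finite set of vertices -/

namespace ConnectedMatchingRamsey

variable {V : Type*}

/-- `M` is (the edge set of) a matching of `G` all of whose ends lie in `U`. -/
structure IsMatchingIn (G : SimpleGraph V) (U : Finset V) (M : Finset (Sym2 V)) : Prop where
  mem_edgeSet : ∀ e ∈ M, e ∈ G.edgeSet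
  mem_of_mem : ∀ e ∈ M, ∀ x ∈ e, x ∈ U
  eq_of_mem : ∀ e ∈ M, ∀ f ∈ M, ∀ x, x ∈ e → x ∈ f → e = f

variable {G : SimpleGraph V} {U W : Finset V} {M N : Finset (Sym2 V)}

lemma isMatchingIn_empty : IsMatchingIn G U ∅ := ⟨by simp, by simp, by simp⟩

lemma IsMatchingIn.subset (h : IsMatchingIn G U M) (hN : N ⊆ M) : IsMatchingIn G U N :=
  ⟨fun e he => h.mem_edgeSet e (hN he), fun e he => h.mem_of_mem e (hN he),
    fun e he f hf => h.eq_of_mem e (hN he) f (hN hf)⟩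

/-- `x` and `y` are joined by a path of `G` inside `U`; this also holds if `x = y`, even
outside `U`. -/
def Linked (G : SimpleGraph V) (U : Finset V) : V → V → Prop :=
  Relation.ReflTransGen fun x y => G.Adj x y ∧ x ∈ U ∧ y ∈ U

lemma Linked.symm {x y : V} (h : Linked G U x y) : Linked G U y x :=
  haveI : Std.Symm fun x y => G.Adj x y ∧ x ∈ U ∧ y ∈ U := ⟨fun _ _ h => ⟨h.1.symm, h.2.2, h.2.1⟩⟩
  Relation.ReflTransGen.stdSymm.symm _ _ h

lemma Linked.trans {x y z : V} (h : Linked G U x y) (h' : Linked G U y z) : Linked G U x z :=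
  Relation.ReflTransGen.trans h h'

lemma Linked.of_adj {x y : V} (h : G.Adj x y) (hx : x ∈ U) (hy : y ∈ U) : Linked G U x y :=
  Relation.ReflTransGen.single ⟨h, hx, hy⟩

lemma Linked.mono {x y : V} (h : Linked G U x y) (hUW : U ⊆ W) : Linked G W x y :=
  Relation.ReflTransGen.mono (fun _ _ h => ⟨h.1, hUW h.2.1, hUW h.2.2⟩) _ _ h

lemma Linked.reachable {x y : V} (h : Linked G U x y) : G.Reachable x y := by
  induction h with
  | refl => exact .refl _
  | tail _ h ih => exact ih.trans h.1.reachable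

lemma exists_linked {G : Fin 3 → SimpleGraph V}
    (hcov : ∀ x ∈ U, ∀ y ∈ U, x ≠ y → ∃ l, (G l).Adj x y) :
    ∀ x ∈ U, ∀ y ∈ U, ∃ l, Linked (G l) U x y := by
  intro x hx y hy
  by_cases hxy : x = y
  · exact ⟨0, hxy ▸ .refl⟩
  · obtain ⟨l, hl⟩ := hcov x hx y hy hxy
    exact ⟨l, .of_adj hl hx hy⟩

variable [DecidableEq V]

/-- The vertices covered by a set of edges. -/
def ends (M : Finset (Sym2 V)) : Finset V := M.biUnion Sym2.toFinset

lemma mem_ends {M : Finset (Sym2 V)} {x : V} : x ∈ ends M ↔ ∃ e ∈ M, x ∈ e := by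
  simp [ends]

lemma IsMatchingIn.ends_subset (h : IsMatchingIn G U M) : ends M ⊆ U := by
  intro x hx
  obtain ⟨e, he, hxe⟩ := mem_ends.1 hx
  exact h.mem_of_mem e he x hxe

lemma IsMatchingIn.of_ends_subset (h : IsMatchingIn G U M) (hW : ends M ⊆ W) :
    IsMatchingIn G W M :=
  ⟨h.mem_edgeSet, fun e he _ hx => hW (mem_ends.2 ⟨e, he, hx⟩), h.eq_of_mem⟩

lemma IsMatchingIn.mono (h : IsMatchingIn G U M) (hW : U ⊆ W) : IsMatchingIn G W M :=
  h.of_ends_subset (h.ends_subset.trans hW)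

lemma IsMatchingIn.card_ends (h : IsMatchingIn G U M) : (ends M).card = 2 * M.card := by
  rw [ends, Finset.card_biUnion, Finset.sum_const_nat (m := 2), mul_comm]
  · intro e he
    exact Sym2.card_toFinset_of_not_isDiag e (G.not_isDiag_of_mem_edgeSet (h.mem_edgeSet e he))
  · intro e he f hf hef
    refine Finset.disjoint_left.2 fun x hxe hxf => ?_
    exact hef (h.eq_of_mem e he f hf x (by simpa using hxe) (by simpa using hxf))

lemma IsMatchingIn.insert_edge (h : IsMatchingIn G U M) {a b : V} (hab : G.Adj a b) (haU : a ∈ U)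
    (hbU : b ∈ U) (ha : a ∉ ends M) (hb : b ∉ ends M) :
    IsMatchingIn G U (insert s(a, b) M) ∧ (insert s(a, b) M).card = M.card + 1 := by
  have hdisj : ∀ f ∈ M, ∀ x, x ∈ s(a, b) → x ∉ f := by
    intro f hf x hx hxf
    rcases Sym2.mem_iff.1 hx with rfl | rfl
    · exact ha (mem_ends.2 ⟨f, hf, hxf⟩)
    · exact hb (mem_ends.2 ⟨f, hf, hxf⟩)
  refine ⟨⟨?_, ?_, ?_⟩, Finset.card_insert_of_notMem fun he => hdisj _ he a (by simp) (by simp)⟩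
  · intro e he
    rcases Finset.mem_insert.1 he with rfl | he
    · exact hab
    · exact h.mem_edgeSet e he
  · intro e he x hx
    rcases Finset.mem_insert.1 he with rfl | he
    · rcases Sym2.mem_iff.1 hx with rfl | rfl <;> assumption
    · exact h.mem_of_mem e he x hx
  · intro e he f hf x hxe hxf
    rcases Finset.mem_insert.1 he with rfl | he <;> rcases Finset.mem_insert.1 hf with rfl | hf
    · rfl
    · exact (hdisj f hf x hxe hxf).elim
    · exact (hdisj e he x hxf hxe).elim
    · exact h.eq_of_mem e he f hf x hxe hxf

/-- A matching inside `B` extends by `A.card` edges between `A` and `B` when these are completely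
joined and enough vertices of `B` are free. -/
lemma IsMatchingIn.exists_extend {A B : Finset V} (hAB : Disjoint A B)
    (hadj : ∀ a ∈ A, ∀ b ∈ B, G.Adj a b) (hM : IsMatchingIn G B M)
    (hcard : A.card + 2 * M.card ≤ B.card) :
    ∃ M', IsMatchingIn G (A ∪ B) M' ∧ M'.card = M.card + A.card := by
  induction A using Finset.induction_on generalizing B with
  | empty => exact ⟨M, by simpa using hM, by simp⟩
  | insert a A ha ih =>
    rw [Finset.card_insert_of_notMem ha] at hcard
    obtain ⟨b, hb, hbM⟩ : ∃ b ∈ B, b ∉ ends M := by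
      apply Finset.exists_mem_notMem_of_card_lt_card
      have := hM.card_ends
      omega
    have haB : a ∉ B := Finset.disjoint_left.1 hAB (Finset.mem_insert_self a A)
    have hbA : b ∉ A := fun h =>
      Finset.disjoint_left.1 hAB (Finset.mem_insert_of_mem h) hb
    obtain ⟨M', hM', hc⟩ := ih (B := B.erase b)
      (Finset.disjoint_of_subset_left (Finset.subset_insert a A)
        (Finset.disjoint_of_subset_right (Finset.erase_subset b B) hAB))
      (fun x hx y hy => hadj x (Finset.mem_insert_of_mem hx) y (Finset.mem_of_mem_erase hy))
      (hM.of_ends_subset fun x hx => Finset.mem_erase.2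
        ⟨fun h => hbM (h ▸ hx), hM.ends_subset hx⟩)
      (by rw [Finset.card_erase_of_mem hb]; omega)
    have haM' : a ∉ ends M' := fun h => by
      have := hM'.ends_subset h
      simp_all
    have hbM' : b ∉ ends M' := fun h => by
      have := hM'.ends_subset h
      simp_all
    have hsub : A ∪ B.erase b ⊆ insert a A ∪ B :=
      Finset.union_subset_union (Finset.subset_insert a A) (Finset.erase_subset b B)
    obtain ⟨h₁, h₂⟩ := (hM'.mono hsub).insert_edge (hadj a (Finset.mem_insert_self a A) b hb)
      (by simp) (by simp [hb]) haM' hbM'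
    exact ⟨_, h₁, by rw [h₂, hc, Finset.card_insert_of_notMem ha]; omega⟩

/-! ### Gallai's lemma and barriers -/

/-- The exchange step of Gallai's lemma. Suppose some matching of the maximum size `μ` misses `y`.
If no maximum matching misses `x` and `y`, and none misses `y` and `z`, then none misses `x`
and `z`. -/
lemma no_max_matching_misses_trans [Finite V] {μ : ℕ} {x y z : V}
    (hmax : ∀ M, IsMatchingIn G U M → M.card ≤ μ)
    (hy : ∃ N, IsMatchingIn G U N ∧ N.card = μ ∧ y ∉ ends N)
    (hxy : ∀ M, IsMatchingIn G U M → M.card = μ → x ∉ ends M → y ∈ ends M)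
    (hyz : ∀ M, IsMatchingIn G U M → M.card = μ → z ∉ ends M → y ∈ ends M)
    (hxz : x ≠ z) (hM : IsMatchingIn G U M) (hMμ : M.card = μ) (hx : x ∉ ends M) :
    z ∈ ends M := by
  classical
  have := Fintype.ofFinite V
  by_contra hz
  -- Among the maximum matchings missing `y`, take `N` with the most edges in common with `M`.
  obtain ⟨N, hN, hbest⟩ := Finset.exists_max_image
    (Finset.univ.filter fun N : Finset (Sym2 V) => IsMatchingIn G U N ∧ N.card = μ ∧ y ∉ ends N)
    (fun N => (M ∩ N).card) (by obtain ⟨N, hN⟩ := hy; exact ⟨N, by simpa using hN⟩)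
  obtain ⟨hN, hNμ, hyN⟩ := (Finset.mem_filter.1 hN).2
  have hyM : y ∈ ends M := hxy M hM hMμ hx
  have hxN : x ∈ ends N := by_contra fun h => hyN (hxy N hN hNμ h)
  have hzN : z ∈ ends N := by_contra fun h => hyN (hyz N hN hNμ h)
  -- `N` covers `x` and `z`, which `M` misses, so `M` covers some `t ≠ y` missed by `N`.
  have hcard : 1 < (ends M \ ends N).card := by
    rw [Finset.card_sdiff_comm (t := ends N)
      (by rw [hM.card_ends, hN.card_ends, hMμ, hNμ])]
    exact Finset.one_lt_card.2 ⟨x, by simp [hxN, hx], z, by simp [hzN, hz], hxz⟩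
  obtain ⟨t, ht, hty⟩ := Finset.exists_mem_ne hcard y
  obtain ⟨htM, htN⟩ := Finset.mem_sdiff.1 ht
  obtain ⟨e, he, hte⟩ := mem_ends.1 htM
  obtain ⟨q, rfl⟩ := Sym2.mem_iff_exists.1 hte
  have htq : G.Adj t q := hM.mem_edgeSet _ he
  have htU : t ∈ U := hM.mem_of_mem _ he t (by simp)
  have hqU : q ∈ U := hM.mem_of_mem _ he q (by simp)
  have hqN : q ∈ ends N := by
    by_contra hqN
    obtain ⟨h₁, h₂⟩ := hN.insert_edge htq htU hqU htN hqN
    have := hmax _ h₁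
    omega
  obtain ⟨f, hf, hqf⟩ := mem_ends.1 hqN
  have hfM : f ∉ M := fun hfM => htN <| mem_ends.2
    ⟨f, hf, by rw [hM.eq_of_mem f hfM _ he q hqf (by simp)]; simp⟩
  -- Replacing the edge of `N` at `q` by `tq` contradicts the choice of `N`.
  have hends : ∀ v ∈ ends (N.erase f), v ∈ ends N := fun v hv => by
    obtain ⟨g, hg, hvg⟩ := mem_ends.1 hv
    exact mem_ends.2 ⟨g, Finset.mem_of_mem_erase hg, hvg⟩
  have hq' : q ∉ ends (N.erase f) := fun h => by
    obtain ⟨g, hg, hqg⟩ := mem_ends.1 h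
    exact Finset.ne_of_mem_erase hg
      (hN.eq_of_mem g (Finset.mem_of_mem_erase hg) f hf q hqg hqf)
  obtain ⟨h₁, h₂⟩ := (hN.subset (Finset.erase_subset f N)).insert_edge htq htU hqU
    (fun h => htN (hends t h)) hq'
  have hy' : y ∉ ends (insert s(t, q) (N.erase f)) := fun h => by
    obtain ⟨g, hg, hyg⟩ := mem_ends.1 h
    rcases Finset.mem_insert.1 hg with rfl | hg
    · rcases Sym2.mem_iff.1 hyg with rfl | rfl
      · exact hty rfl
      · exact hyN hqN
    · exact hyN (hends y (mem_ends.2 ⟨g, hg, hyg⟩))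
  have hlt : (M ∩ N).card < (M ∩ insert s(t, q) (N.erase f)).card := by
    apply Finset.card_lt_card
    rw [Finset.ssubset_iff]
    refine ⟨s(t, q), fun h => htN (mem_ends.2 ⟨_, (Finset.mem_inter.1 h).2, by simp⟩), ?_⟩
    intro g hg
    rcases Finset.mem_insert.1 hg with rfl | hg
    · simp [he]
    · obtain ⟨hgM, hgN⟩ := Finset.mem_inter.1 hg
      have : g ≠ f := fun h => hfM (h ▸ hgM)
      simp [hgM, hgN, this]
  have hpos : 0 < N.card := Finset.card_pos.2 ⟨f, hf⟩
  rw [Finset.card_erase_of_mem hf] at h₂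
  exact absurd (hbest _ (by simp only [Finset.mem_filter, Finset.mem_univ, true_and]
                            exact ⟨h₁, by omega, hy'⟩)) (by simpa using hlt)

/-- Gallai's lemma. If every vertex of `U` is missed by some maximum matching, then every
maximum matching misses at most one vertex of each connected part of `U`. -/
lemma mem_ends_of_linked [Finite V] {μ : ℕ} (hmax : ∀ M, IsMatchingIn G U M → M.card ≤ μ)
    (hmiss : ∀ y ∈ U, ∃ N, IsMatchingIn G U N ∧ N.card = μ ∧ y ∉ ends N) {x z : V}
    (h : Linked G U x z) :
    x ≠ z → ∀ M, IsMatchingIn G U M → M.card = μ → x ∉ ends M → z ∈ ends M := by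
  induction h with
  | refl => exact fun h => (h rfl).elim
  | @tail y z _ hyz ih =>
    intro hxz M hM hMμ hx
    have hadj : ∀ M, IsMatchingIn G U M → M.card = μ → z ∉ ends M → y ∈ ends M := by
      intro M hM hMμ hz
      by_contra hy
      obtain ⟨h₁, h₂⟩ := hM.insert_edge hyz.1 hyz.2.1 hyz.2.2 hy hz
      have := hmax _ h₁
      omega
    by_cases hxy : x = y
    · subst hxy
      exact by_contra fun hz => hx (hadj M hM hMμ hz)
    · exact no_max_matching_misses_trans hmax (hmiss y hyz.2.1) (ih hxy) hadj hxz hM hMμ hx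

/-- A barrier: if the matchings inside `D` have at most `a` edges, then deleting a suitable
`S ⊆ D` lowers this bound by `S.card` and leaves parts of at most `2 * (a - S.card) + 1` vertices.
A largest set `S` with the first property works: no further vertex is covered by all maximum
matchings of the rest, so Gallai's lemma applies there. -/
lemma exists_barrier [Finite V] {D : Finset V} {a : ℕ}
    (hD : ∀ M, IsMatchingIn G D M → M.card ≤ a) :
    ∃ S ⊆ D, (∀ M, IsMatchingIn G (D \ S) M → M.card + S.card ≤ a) ∧
      ∀ K ⊆ D \ S, (∀ x ∈ K, ∀ y ∈ K, Linked G (D \ S) x y) → K.card + 2 * S.card ≤ 2 * a + 1 := by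
  classical
  obtain ⟨S, hS, hbest⟩ := Finset.exists_max_image
    (D.powerset.filter fun S => ∀ M, IsMatchingIn G (D \ S) M → M.card + S.card ≤ a)
    Finset.card ⟨∅, by simpa using hD⟩
  simp only [Finset.mem_filter, Finset.mem_powerset] at hS hbest
  refine ⟨S, hS.1, hS.2, fun K hK hKl => ?_⟩
  have ha : S.card ≤ a := by simpa using hS.2 ∅ isMatchingIn_empty
  rcases K.eq_empty_or_nonempty with rfl | ⟨x, hx⟩
  · simp only [Finset.card_empty]; omega
  have hmiss : ∀ y ∈ D \ S, ∃ N, IsMatchingIn G (D \ S) N ∧ N.card = a - S.card ∧ y ∉ ends N := by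
    intro y hy
    obtain ⟨hyD, hyS⟩ := Finset.mem_sdiff.1 hy
    by_contra hcon
    push Not at hcon
    have := hbest (insert y S) ⟨Finset.insert_subset hyD hS.1, fun M hM => by
      have hM' := hM.mono (Finset.sdiff_subset_sdiff subset_rfl (Finset.subset_insert y S))
      have h₁ := hS.2 M hM'
      have h₂ : M.card ≠ a - S.card := fun h => by
        have := hM.ends_subset (hcon M hM' h)
        simp at this
      rw [Finset.card_insert_of_notMem hyS]
      omega⟩
    rw [Finset.card_insert_of_notMem hyS] at this
    omega
  obtain ⟨N, hN, hNc, hxN⟩ := hmiss x (hK hx)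
  have hsub : K.erase x ⊆ ends N := fun z hz =>
    mem_ends_of_linked (fun M hM => by have := hS.2 M hM; omega) hmiss
      (hKl x hx z (Finset.mem_of_mem_erase hz)) (Finset.ne_of_mem_erase hz).symm N hN hNc hxN
  have := Finset.card_le_card hsub
  rw [Finset.card_erase_of_mem hx, hN.card_ends] at this
  omega

/-! ### Three pairwise meeting equivalence relations -/

lemma fin_three_cases {i j k : Fin 3} (hij : i ≠ j) (hik : i ≠ k) (hjk : j ≠ k) (l : Fin 3) :
    l = i ∨ l = j ∨ l = k := by
  revert i j k l; decide

lemma sum_fin_three {i j k : Fin 3} (hij : i ≠ j) (hik : i ≠ k) (hjk : j ≠ k) (f : Fin 3 → ℕ) :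
    ∑ l, f l = f i + f j + f k := by
  have : (Finset.univ : Finset (Fin 3)) = {i, j, k} := by revert i j k; decide
  rw [this, Finset.sum_insert (by simp [hij, hik]), Finset.sum_pair hjk, add_assoc]

/-- If two elements are related by exactly two of the relations, and no single relation relates
everything, then there are central classes, one for each relation, such that every element lies in
at least two of them. -/
lemma exists_central_classes {α : Type*} {U : Finset α} {R : Fin 3 → α → α → Prop}
    (hsymm : ∀ l x y, R l x y → R l y x) (htrans : ∀ l x y z, R l x y → R l y z → R l x z)
    (hmeet : ∀ x ∈ U, ∀ y ∈ U, ∃ l, R l x y) (hns : ∀ l, ∀ x ∈ U, ∃ w ∈ U, ¬ R l x w)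
    {i j k : Fin 3} (hij : i ≠ j) (hik : i ≠ k) (hjk : j ≠ k) {u v : α} (hu : u ∈ U) (hv : v ∈ U)
    (hi : R i u v) (hj : R j u v) (hk : ¬ R k u v) :
    ∃ p : Fin 3 → α,
      (∀ x ∈ U, ∀ l l', l ≠ l' → R l (p l) x ∨ R l' (p l') x) ∧
      ∀ l, ∃ x ∈ U, ¬ R l (p l) x := by
  have hcases := fin_three_cases hij hik hjk
  obtain ⟨w, hw, hiw⟩ := hns i u hu
  obtain ⟨w', hw', hjw'⟩ := hns j u hu
  have h₁ : ∀ x ∈ U, ¬ R i u x → R j u x := by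
    intro x hx hix
    by_contra hjx
    obtain ⟨l, hl⟩ := hmeet u hu x hx
    obtain ⟨l', hl'⟩ := hmeet v hv x hx
    rcases hcases l with rfl | rfl | rfl
    · exact hix hl
    · exact hjx hl
    rcases hcases l' with rfl | rfl | rfl
    · exact hix (htrans _ _ _ _ hi hl')
    · exact hjx (htrans _ _ _ _ hj hl')
    · exact hk (htrans _ _ _ _ hl (hsymm _ _ _ hl'))
  have h₂ : ∀ x ∈ U, ¬ R i u x → ∀ y ∈ U, ¬ R j u y → R k x y := by
    intro x hx hix y hy hjy
    obtain ⟨l, hl⟩ := hmeet x hx y hy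
    have hiy : R i u y := by_contra fun h => hjy (h₁ y hy h)
    rcases hcases l with rfl | rfl | rfl
    · exact (hix (htrans _ _ _ _ hiy (hsymm _ _ _ hl))).elim
    · exact (hjy (htrans _ _ _ _ (h₁ x hx hix) hl)).elim
    · exact hl
  have hpi : (if i = k then w else u) = u := if_neg hik
  have hpj : (if j = k then w else u) = u := if_neg hjk
  have hik' : ∀ x ∈ U, R i u x ∨ R k w x := fun x hx => by
    by_contra! h
    exact h.2 (htrans _ _ _ _ (h₂ w hw hiw w' hw' hjw') (hsymm _ _ _ (h₂ x hx h.1 w' hw' hjw')))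
  have hjk' : ∀ x ∈ U, R j u x ∨ R k w x := fun x hx => by
    by_contra! h
    exact h.2 (h₂ w hw hiw x hx h.1)
  have hij' : ∀ x ∈ U, R i u x ∨ R j u x := fun x hx => by
    by_contra! h
    exact h.2 (h₁ x hx h.1)
  -- The classes of `u` for `i` and `j`; for `k` the class of `w`, which contains every element
  -- unrelated to `u` by `i` or by `j`.
  refine ⟨fun l => if l = k then w else u, fun x hx l l' hll' => ?_, fun l => ?_⟩
  · rcases hcases l with rfl | rfl | rfl <;> rcases hcases l' with rfl | rfl | rfl <;>
      simp only [hpi, hpj, if_true] <;>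
      first
        | exact (hll' rfl).elim
        | exact hij' x hx
        | exact (hij' x hx).symm
        | exact hik' x hx
        | exact (hik' x hx).symm
        | exact hjk' x hx
        | exact (hjk' x hx).symm
  · rcases hcases l with rfl | rfl | rfl <;> simp only [hpi, hpj, if_true]
    · exact ⟨w, hw, hiw⟩
    · exact ⟨w', hw', hjw'⟩
    · by_contra! h
      exact hk (htrans _ _ _ _ (hsymm _ _ _ (h u hu)) (h v hv))

/-! ### Bounding the number of vertices -/

/-- For each colour `i`, the matchings of `G i` inside `U` that lie in a single component of
`G i` restricted to `U` have at most `a i` edges. -/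
def ConnectedMatchingsLE (G : Fin 3 → SimpleGraph V) (U : Finset V) (a : Fin 3 → ℕ) : Prop :=
  ∀ i, ∀ D ⊆ U, (∀ x ∈ D, ∀ y ∈ D, Linked (G i) U x y) →
    ∀ M, IsMatchingIn (G i) D M → M.card ≤ a i

/-- The bound to be proved, for all proper subsets of `U`: the form in which it is used in the
induction on `U.card`. -/
def BoundBelow (G : Fin 3 → SimpleGraph V) (U : Finset V) (m : ℕ) : Prop :=
  ∀ U' ⊂ U, ∀ a : Fin 3 → ℕ, (∀ i, a i ≤ m) → ConnectedMatchingsLE G U' a →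
    U'.card ≤ ∑ i, a i + m + 1

variable {G : Fin 3 → SimpleGraph V} {a : Fin 3 → ℕ} {m : ℕ}

/-- Deleting barriers `S l`, for the colours `l ∈ T`, reduces to a smaller vertex set if in these
colours only the parts `P l` survive: the bound decreases by as much as the number of vertices. -/
lemma card_le_of_delete (hIH : BoundBelow G U m) (ham : ∀ i, a i ≤ m)
    (hG : ConnectedMatchingsLE G U a) {P S : Fin 3 → Finset V} (T : Finset (Fin 3))
    (hSU : ∀ l ∈ T, S l ⊆ U)
    (hS : ∀ l ∈ T, ∀ M, IsMatchingIn (G l) (P l \ S l) M → M.card + (S l).card ≤ a l)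
    (hT : ∀ l ∈ T, U \ T.biUnion S ⊆ P l) (hne : (T.biUnion S).Nonempty) :
    U.card ≤ ∑ i, a i + m + 1 := by
  have hsub : T.biUnion S ⊆ U := Finset.biUnion_subset.2 hSU
  have hSa : ∀ l ∈ T, (S l).card ≤ a l := fun l hl => by simpa using hS l hl ∅ isMatchingIn_empty
  have h := hIH (U \ T.biUnion S) (Finset.sdiff_ssubset hsub hne)
    (fun l => a l - if l ∈ T then (S l).card else 0)
    (fun l => (Nat.sub_le _ _).trans (ham l)) (by
      intro l D hD hDl M hM
      have hMa := hG l D (hD.trans Finset.sdiff_subset)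
        (fun x hx y hy => (hDl x hx y hy).mono Finset.sdiff_subset) M hM
      dsimp only
      split_ifs with hl
      · have := hS l hl M (hM.mono fun x hx => Finset.mem_sdiff.2 ⟨hT l hl (hD hx), fun hxS =>
          (Finset.mem_sdiff.1 (hD hx)).2 (Finset.mem_biUnion.2 ⟨l, hl, hxS⟩)⟩)
        omega
      · simpa using hMa)
  have hsum : ∑ l, (a l - if l ∈ T then (S l).card else 0) + ∑ l ∈ T, (S l).card = ∑ l, a l := by
    have : ∑ l ∈ T, (S l).card = ∑ l, if l ∈ T then (S l).card else 0 := by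
      simp [Finset.sum_ite_mem]
    rw [this, ← Finset.sum_add_distrib]
    refine Finset.sum_congr rfl fun l _ => ?_
    split_ifs with hl
    · have := hSa l hl
      omega
    · simp
  have h₁ := Finset.card_sdiff_add_card_eq_card hsub
  have h₂ : (T.biUnion S).card ≤ ∑ l ∈ T, (S l).card := Finset.card_biUnion_le
  omega

/-- The bound when some colour connects all of `U`. -/
lemma card_le_of_linked [Finite V] (hIH : BoundBelow G U m) (ham : ∀ i, a i ≤ m)
    (hG : ConnectedMatchingsLE G U a) {i : Fin 3} (hi : ∀ x ∈ U, ∀ y ∈ U, Linked (G i) U x y) :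
    U.card ≤ ∑ i, a i + m + 1 := by
  obtain ⟨S, hSU, hS, hK⟩ := exists_barrier (hG i U subset_rfl hi)
  rcases S.eq_empty_or_nonempty with rfl | hne
  · have h₁ := hK U (by simp) (by simpa using hi)
    have h₂ : a i ≤ ∑ l, a l := Finset.single_le_sum (fun _ _ => Nat.zero_le _) (Finset.mem_univ i)
    have := ham i
    simp only [Finset.card_empty] at h₁
    omega
  · refine card_le_of_delete hIH ham hG (P := fun _ => U) (S := fun _ => S) {i} (fun _ _ => hSU)
      (fun l hl M hM => ?_) (fun l _ => Finset.sdiff_subset) (by simpa using hne)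
    obtain rfl := Finset.mem_singleton.1 hl
    exact hS M hM

/-- If every pair between `A` and `B` is an edge of colour `k`, one of `A` and `B` has at most
`a k` elements. -/
lemma card_le_or_card_le_of_complete (hG : ConnectedMatchingsLE G U a) {k : Fin 3} {A B : Finset V}
    (hAU : A ⊆ U) (hBU : B ⊆ U) (hAB : Disjoint A B)
    (hadj : ∀ x ∈ A, ∀ y ∈ B, (G k).Adj x y) : A.card ≤ a k ∨ B.card ≤ a k := by
  by_contra! h
  obtain ⟨x₀, hx₀⟩ := Finset.card_pos.1 (Nat.zero_lt_of_lt h.1)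
  obtain ⟨y₀, hy₀⟩ := Finset.card_pos.1 (Nat.zero_lt_of_lt h.2)
  obtain ⟨A', hA', hA'c⟩ := Finset.exists_subset_card_eq (Nat.succ_le_of_lt h.1)
  obtain ⟨M, hM, hMc⟩ := (isMatchingIn_empty (G := G k) (U := B)).exists_extend
    (Finset.disjoint_of_subset_left hA' hAB) (fun x hx => hadj x (hA' hx))
    (by simp only [Finset.card_empty]; omega)
  have hl : ∀ x ∈ A, ∀ y ∈ B, Linked (G k) U x y := fun x hx y hy =>
    Linked.of_adj (hadj x hx y hy) (hAU hx) (hBU hy)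
  have hx₀l : ∀ y ∈ A ∪ B, Linked (G k) U x₀ y := fun y hy => by
    rcases Finset.mem_union.1 hy with hy | hy
    · exact (hl x₀ hx₀ y₀ hy₀).trans (hl y hy y₀ hy₀).symm
    · exact hl x₀ hx₀ y hy
  have := hG k (A ∪ B) (Finset.union_subset hAU hBU)
    (fun x hx y hy => (hx₀l x hx).symm.trans (hx₀l y hy)) M
    (hM.mono (Finset.union_subset_union hA' subset_rfl))
  simp only [Finset.card_empty] at hMc
  omega

/-- The main case of the majority configuration: every vertex lies in at least two of the
components `P l`. Suppose that `w` lies outside `P k` and survives the deletion of the barriers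
`S i` and `S j`, and that `u` lies outside `P i` and survives the deletion of `S j`. Then the
parts of `w` left by the two barriers cover everything that remains, and between their differences
there are only edges of colour `k`. -/
lemma card_le_of_two_parts [Finite V] (ham : ∀ i, a i ≤ m)
    (hcov : ∀ x ∈ U, ∀ y ∈ U, x ≠ y → ∃ l, (G l).Adj x y)
    (hG : ConnectedMatchingsLE G U a) {P S : Fin 3 → Finset V}
    (hP : ∀ l, ∀ x ∈ P l, ∀ y ∈ U, (G l).Adj x y → y ∈ P l)
    (hmaj : ∀ x ∈ U, ∀ l l', l ≠ l' → x ∈ P l ∨ x ∈ P l')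
    (hSa : ∀ l, (S l).card ≤ a l)
    (hK : ∀ l, ∀ K ⊆ P l \ S l, (∀ x ∈ K, ∀ y ∈ K, Linked (G l) (P l \ S l) x y) →
      K.card + 2 * (S l).card ≤ 2 * a l + 1)
    {i j k : Fin 3} (hij : i ≠ j) (hik : i ≠ k) (hjk : j ≠ k) {w u : V} (hw : w ∈ U) (hu : u ∈ U)
    (hwk : w ∉ P k) (hwi : w ∉ S i) (hwj : w ∉ S j) (hui : u ∉ P i) (huj : u ∉ S j) :
    U.card ≤ ∑ i, a i + m + 1 := by
  classical
  have hcases := fin_three_cases hij hik hjk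
  have hP' : ∀ l, ∀ x ∈ U, ∀ y ∈ P l, (G l).Adj x y → x ∈ P l := fun l x hx y hy h =>
    hP l y hy x hx h.symm
  have hwPi : w ∈ P i := (hmaj w hw i k hik).resolve_right hwk
  have hwPj : w ∈ P j := (hmaj w hw j k hjk).resolve_right hwk
  have huPj : u ∈ P j := (hmaj u hu i j hij).resolve_left hui
  have huPk : u ∈ P k := (hmaj u hu i k hik).resolve_left hui
  -- The part of `w` in colour `l` after deleting the barrier.
  set B : Fin 3 → Finset V := fun l => (P l \ S l).filter (Linked (G l) (P l \ S l) w) with hB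
  have hmemB : ∀ l x, x ∈ B l ↔ (x ∈ P l ∧ x ∉ S l) ∧ Linked (G l) (P l \ S l) w x := by
    simp [hB]
  have hBcard : ∀ l, (B l).card + 2 * (S l).card ≤ 2 * a l + 1 := fun l =>
    hK l (B l) (Finset.filter_subset _ _) fun x hx y hy =>
      ((hmemB l x).1 hx).2.symm.trans ((hmemB l y).1 hy).2
  have hBadj : ∀ l, ∀ x ∈ B l, ∀ y ∈ U, y ∉ S l → (G l).Adj x y → y ∈ B l := by
    intro l x hx y hy hyS hxy
    obtain ⟨⟨hxP, hxS⟩, hwx⟩ := (hmemB l x).1 hx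
    have hyP := hP l x hxP y hy hxy
    exact (hmemB l y).2 ⟨⟨hyP, hyS⟩, hwx.trans
      (.of_adj hxy (Finset.mem_sdiff.2 ⟨hxP, hxS⟩) (Finset.mem_sdiff.2 ⟨hyP, hyS⟩))⟩
  have hwBi : w ∈ B i := (hmemB i w).2 ⟨⟨hwPi, hwi⟩, .refl⟩
  have hwBj : w ∈ B j := (hmemB j w).2 ⟨⟨hwPj, hwj⟩, .refl⟩
  -- The edges between `u` and the vertices outside `P k` have colour `j`.
  have huadj : ∀ x ∈ U, x ∉ P k → (G j).Adj x u := by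
    intro x hx hxk
    obtain ⟨l, hl⟩ := hcov x hx u hu fun h => hxk (h ▸ huPk)
    rcases hcases l with rfl | rfl | rfl
    · exact (hui (hP l x ((hmaj x hx l k hik).resolve_right hxk) u hu hl)).elim
    · exact hl
    · exact (hxk (hP' l x hx u huPk hl)).elim
  have huB : u ∈ B j := hBadj j w hwBj u hu huj (huadj w hw hwk)
  set U' := U \ (S i ∪ S j) with hU'
  have hmemU' : ∀ x, x ∈ U' ↔ x ∈ U ∧ x ∉ S i ∧ x ∉ S j := by simp [hU']
  have hcover : ∀ x ∈ U', x ∈ B i ∨ x ∈ B j := by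
    intro x hx
    obtain ⟨hxU, hxi, hxj⟩ := (hmemU' x).1 hx
    by_cases hwx : w = x
    · exact .inl (hwx ▸ hwBi)
    obtain ⟨l, hl⟩ := hcov w hw x hxU hwx
    rcases hcases l with rfl | rfl | rfl
    · exact .inl (hBadj l w hwBi x hxU hxi hl)
    · exact .inr (hBadj l w hwBj x hxU hxj hl)
    · have hxk : x ∉ P l := fun h => hwk (hP' l w hw x h hl)
      exact .inr (hBadj j u huB x hxU hxj (huadj x hxU hxk).symm)
  have hadj : ∀ x ∈ U' \ B j, ∀ y ∈ U' \ B i, (G k).Adj x y := by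
    intro x hx y hy
    obtain ⟨hx, hxB⟩ := Finset.mem_sdiff.1 hx
    obtain ⟨hy, hyB⟩ := Finset.mem_sdiff.1 hy
    obtain ⟨hxU, hxi, hxj⟩ := (hmemU' x).1 hx
    obtain ⟨hyU, hyi, hyj⟩ := (hmemU' y).1 hy
    have hxBi := (hcover x hx).resolve_right hxB
    have hyBj := (hcover y hy).resolve_left hyB
    obtain ⟨l, hl⟩ := hcov x hxU y hyU fun h => hxB (h ▸ hyBj)
    rcases hcases l with rfl | rfl | rfl
    · exact (hyB (hBadj l x hxBi y hyU hyi hl)).elim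
    · exact (hxB (hBadj l y hyBj x hxU hxj hl.symm)).elim
    · exact hl
  have hdisj : Disjoint (U' \ B j) (U' \ B i) := Finset.disjoint_left.2 fun x hx hx' =>
    (hadj x hx x hx').ne rfl
  have h₁ : U.card ≤ U'.card + ((S i).card + (S j).card) := by
    have h₁ : U.card - (S i ∪ S j).card ≤ U'.card := Finset.le_card_sdiff (S i ∪ S j) U
    have h₂ := Finset.card_union_le (S i) (S j)
    omega
  have h₂ : U'.card ≤ (U' \ B j).card + (B j).card := by
    have := Finset.le_card_sdiff (B j) U'
    omega
  have h₃ : U'.card ≤ (U' \ B i).card + (B i).card := by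
    have := Finset.le_card_sdiff (B i) U'
    omega
  have h₄ : (U' \ B j).card ≤ a k ∨ (U' \ B i).card ≤ a k := card_le_or_card_le_of_complete hG
    (Finset.sdiff_subset.trans Finset.sdiff_subset) (Finset.sdiff_subset.trans Finset.sdiff_subset)
    hdisj hadj
  have := hBcard i
  have := hBcard j
  have := hSa i
  have := hSa j
  have := ham i
  have := ham j
  -- One difference has at most `a k` vertices; the rest of `U'` lies in one of
  -- `B i` and `B j`.
  rw [sum_fin_three hij hik hjk a]
  omega

/-- The bound in the majority configuration: every vertex lies in at least two of the components of
the vertices `p l`, and none of these components is all of `U`. -/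
lemma card_le_of_majority [Finite V] (hIH : BoundBelow G U m) (ham : ∀ i, a i ≤ m)
    (hcov : ∀ x ∈ U, ∀ y ∈ U, x ≠ y → ∃ l, (G l).Adj x y) (hG : ConnectedMatchingsLE G U a)
    {p : Fin 3 → V}
    (hmaj : ∀ x ∈ U, ∀ l l', l ≠ l' → Linked (G l) U (p l) x ∨ Linked (G l') U (p l') x)
    (hout : ∀ l, ∃ x ∈ U, ¬ Linked (G l) U (p l) x) :
    U.card ≤ ∑ i, a i + m + 1 := by
  classical
  set P : Fin 3 → Finset V := fun l => U.filter (Linked (G l) U (p l)) with hPdef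
  have hPU : ∀ l, P l ⊆ U := fun l => Finset.filter_subset _ _
  have hPadj : ∀ l, ∀ x ∈ P l, ∀ y ∈ U, (G l).Adj x y → y ∈ P l := by
    intro l x hx y hy hxy
    obtain ⟨hxU, hx⟩ := Finset.mem_filter.1 hx
    exact Finset.mem_filter.2 ⟨hy, hx.trans (.of_adj hxy hxU hy)⟩
  have hPmaj : ∀ x ∈ U, ∀ l l', l ≠ l' → x ∈ P l ∨ x ∈ P l' := by
    intro x hx l l' hll'
    simpa [hPdef, hx] using hmaj x hx l l' hll'
  have hPout : ∀ l, ∃ x ∈ U, x ∉ P l := by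
    intro l
    obtain ⟨x, hx, hxl⟩ := hout l
    exact ⟨x, hx, fun h => hxl (Finset.mem_filter.1 h).2⟩
  choose S hSP hS hK using fun l => exists_barrier (hG l (P l) (hPU l) fun x hx y hy =>
    (Finset.mem_filter.1 hx).2.symm.trans (Finset.mem_filter.1 hy).2)
  have hSa : ∀ l, (S l).card ≤ a l := fun l => by simpa using hS l ∅ isMatchingIn_empty
  have hSU : ∀ l, S l ⊆ U := fun l => (hSP l).trans (hPU l)
  by_cases hall : ∀ l, U \ Finset.univ.biUnion S ⊆ P l
  · refine card_le_of_delete hIH ham hG Finset.univ (fun l _ => hSU l) (fun l _ => hS l)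
      (fun l _ => hall l) ?_
    -- If all the barriers are empty, then `P 0` is all of `U`.
    by_contra hne
    obtain ⟨x, hx, hx'⟩ := hPout 0
    exact hx' (hall 0 (by simpa [Finset.not_nonempty_iff_eq_empty.1 hne] using hx))
  push Not at hall
  obtain ⟨k, hk⟩ := hall
  obtain ⟨w, hw, hwk⟩ := Finset.not_subset.1 hk
  obtain ⟨hwU, hwS⟩ := Finset.mem_sdiff.1 hw
  have hwS : ∀ l, w ∉ S l := fun l h => hwS (Finset.mem_biUnion.2 ⟨l, Finset.mem_univ l, h⟩)
  obtain ⟨i, j, hij, hik, hjk⟩ : ∃ i j : Fin 3, i ≠ j ∧ i ≠ k ∧ j ≠ k :=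
    (by decide : ∀ k : Fin 3, ∃ i j, i ≠ j ∧ i ≠ k ∧ j ≠ k) k
  by_cases hi : ∃ u ∈ U, u ∉ P i ∧ u ∉ S j
  · obtain ⟨u, hu, hui, huj⟩ := hi
    exact card_le_of_two_parts ham hcov hG hPadj hPmaj hSa hK hij hik hjk hwU hu hwk
      (hwS i) (hwS j) hui huj
  by_cases hj : ∃ u ∈ U, u ∉ P j ∧ u ∉ S i
  · obtain ⟨u, hu, huj, hui⟩ := hj
    exact card_le_of_two_parts ham hcov hG hPadj hPmaj hSa hK hij.symm hjk hik hwU hu hwk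
      (hwS j) (hwS i) huj hui
  push Not at hi hj
  refine card_le_of_delete hIH ham hG {i, j} (fun l _ => hSU l) (fun l _ => hS l) ?_ ?_
  · intro l hl x hx
    have hx' : x ∈ U ∧ x ∉ S i ∧ x ∉ S j := by simpa using hx
    rcases Finset.mem_insert.1 hl with rfl | hl
    · exact by_contra fun h => hx'.2.2 (hi x hx'.1 h)
    · obtain rfl := Finset.mem_singleton.1 hl
      exact by_contra fun h => hx'.2.1 (hj x hx'.1 h)
  · obtain ⟨x, hx, hxi⟩ := hPout i
    exact ⟨x, Finset.mem_biUnion.2 ⟨j, by simp, hi x hx hxi⟩⟩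

/-- The bound when any two vertices are linked either in all colours or in exactly one, and no
colour connects `U`. The vertices linked to `z` in all colours form a set `E`; every other vertex
is linked to `z` in exactly one colour `l`, and all its edges to `E` have this colour. If `E` is
largest possible, then matchings of colour `l` inside `E` extend to cover the vertices linked to
`z` in colour `l` only, and the bound for `E` itself applies. -/
lemma card_le_of_linked_in_one_or_all (hIH : BoundBelow G U m) (ham : ∀ i, a i ≤ m)
    (hcov : ∀ x ∈ U, ∀ y ∈ U, x ≠ y → ∃ l, (G l).Adj x y) (hG : ConnectedMatchingsLE G U a)
    (hns : ∀ l, ∀ x ∈ U, ∃ w ∈ U, ¬ Linked (G l) U x w)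
    (hone : ∀ x ∈ U, ∀ y ∈ U, ∀ l l', l ≠ l' → Linked (G l) U x y → Linked (G l') U x y →
      ∀ l'', Linked (G l'') U x y) :
    U.card ≤ ∑ i, a i + m + 1 := by
  classical
  rcases U.eq_empty_or_nonempty with rfl | hUne
  · simp
  have hmeet : ∀ x ∈ U, ∀ y ∈ U, ∃ l, Linked (G l) U x y := exists_linked hcov
  obtain ⟨z, hz, hbest⟩ := Finset.exists_max_image U
    (fun z => (U.filter fun x => ∀ l, Linked (G l) U z x).card) hUne
  set E := U.filter fun x => ∀ l, Linked (G l) U z x with hE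
  set A : Fin 3 → Finset V := fun l => U.filter fun x => Linked (G l) U z x ∧ x ∉ E with hA
  have hEU : E ⊆ U := Finset.filter_subset _ _
  have hAU : ∀ l, A l ⊆ U := fun l => Finset.filter_subset _ _
  have hEl : ∀ l, ∀ x ∈ E, Linked (G l) U z x := fun l x hx => (Finset.mem_filter.1 hx).2 l
  have hAl : ∀ l, ∀ x ∈ A l, Linked (G l) U z x := fun l x hx => (Finset.mem_filter.1 hx).2.1
  have hdisj : ∀ l, Disjoint (A l) E := fun l => Finset.disjoint_left.2 fun x hx =>
    (Finset.mem_filter.1 hx).2.2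
  have hAonly : ∀ l, ∀ x ∈ A l, ∀ l', l' ≠ l → ¬ Linked (G l') U z x := fun l x hx l' hl' h =>
    (Finset.mem_filter.1 hx).2.2
      (Finset.mem_filter.2 ⟨hAU l hx, hone z hz x (hAU l hx) l' l hl' h (hAl l x hx)⟩)
  have hadj : ∀ l, ∀ x ∈ A l, ∀ y ∈ E, (G l).Adj x y := by
    intro l x hx y hy
    obtain ⟨l', hl'⟩ := hcov x (hAU l hx) y (hEU hy)
      (fun h => Finset.disjoint_left.1 (hdisj l) hx (h ▸ hy))
    by_cases hll : l' = l
    · exact hll ▸ hl'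
    · exact (hAonly l x hx l' hll
        ((hEl l' y hy).trans (.of_adj hl'.symm (hEU hy) (hAU l hx)))).elim
  -- Any two vertices of `A l` are linked in all colours, so `A l` is no larger than `E`.
  have hAE : ∀ l, (A l).card ≤ E.card := by
    intro l
    rcases (A l).eq_empty_or_nonempty with h | ⟨u, hu⟩
    · simp [h]
    refine le_trans (Finset.card_le_card fun v hv => ?_) (hbest u (hAU l hu))
    refine Finset.mem_filter.2 ⟨hAU l hv, ?_⟩
    obtain ⟨w, hw, hwl⟩ := hns l z hz
    obtain ⟨j, hj⟩ := hmeet z hz w hw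
    have hjl : j ≠ l := fun h => hwl (h ▸ hj)
    obtain ⟨k, hkj, hkl⟩ : ∃ k : Fin 3, k ≠ j ∧ k ≠ l :=
      (by decide : ∀ j l : Fin 3, ∃ k, k ≠ j ∧ k ≠ l) j l
    have hk : ∀ x ∈ A l, Linked (G k) U x w := fun x hx => by
      obtain ⟨c, hc⟩ := hmeet x (hAU l hx) w hw
      rcases fin_three_cases hjl hkj.symm hkl.symm c with rfl | rfl | rfl
      · exact (hAonly l x hx c hjl (hj.trans hc.symm)).elim
      · exact (hwl ((hAl c x hx).trans hc)).elim
      · exact hc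
    exact hone u (hAU l hu) v (hAU l hv) l k hkl.symm ((hAl l u hu).symm.trans (hAl l v hv))
      ((hk u hu).trans (hk v hv).symm)
  -- A matching inside `E` that leaves enough vertices free extends to cover `A l`.
  have hext : ∀ l, ∀ M, IsMatchingIn (G l) E M → (A l).card + 2 * M.card ≤ E.card →
      M.card + (A l).card ≤ a l := by
    intro l M hM hc
    obtain ⟨M', hM', hM'c⟩ := hM.exists_extend (hdisj l) (hadj l) hc
    rw [← hM'c]
    have hzl : ∀ x ∈ A l ∪ E, Linked (G l) U z x := fun x hx =>
      (Finset.mem_union.1 hx).elim (hAl l x) (hEl l x)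
    exact hG l (A l ∪ E) (Finset.union_subset (hAU l) hEU)
      (fun x hx y hy => (hzl x hx).symm.trans (hzl y hy)) M' hM'
  have hAa : ∀ l, (A l).card ≤ a l := fun l => by
    simpa using hext l ∅ isMatchingIn_empty (by simpa using hAE l)
  have hUc : U.card ≤ E.card + ∑ l, (A l).card := by
    have hsub : U ⊆ E ∪ Finset.univ.biUnion A := fun x hx => by
      by_cases hxE : x ∈ E
      · exact Finset.mem_union_left _ hxE
      · obtain ⟨l, hl⟩ := hmeet z hz x hx
        exact Finset.mem_union_right _ (Finset.mem_biUnion.2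
          ⟨l, Finset.mem_univ l, Finset.mem_filter.2 ⟨hx, hl, hxE⟩⟩)
    have h₁ := Finset.card_le_card hsub
    have h₂ := Finset.card_union_le E (Finset.univ.biUnion A)
    have h₃ : (Finset.univ.biUnion A).card ≤ ∑ l, (A l).card := Finset.card_biUnion_le
    omega
  have hsum : ∑ l, (a l - (A l).card) + ∑ l, (A l).card = ∑ l, a l := by
    rw [← Finset.sum_add_distrib]
    exact Finset.sum_congr rfl fun l _ => Nat.sub_add_cancel (hAa l)
  by_contra hcon
  have hssub : E ⊂ U := by
    obtain ⟨w, hw, hwl⟩ := hns 0 z hz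
    exact Finset.ssubset_iff_subset_ne.2 ⟨hEU, fun h => hwl (hEl 0 w (h ▸ hw))⟩
  have := hIH E hssub (fun l => a l - (A l).card) (fun l => (Nat.sub_le _ _).trans (ham l)) (by
    intro l D hD _ M hM
    dsimp only
    by_contra! hlt
    -- If the extension to `A l` fails for lack of free vertices, then `E` has at most
    -- `a l + (a l - (A l).card) + 1` vertices, and the bound for `U` follows directly.
    obtain ⟨M₀, hM₀, hM₀c⟩ := Finset.exists_subset_card_eq (Nat.succ_le_of_lt hlt)
    have h₁ := hext l M₀ ((hM.mono hD).subset hM₀)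
    have h₂ := hAa l
    have h₃ := ham l
    have h₄ : a l - (A l).card ≤ ∑ l, (a l - (A l).card) :=
      Finset.single_le_sum (f := fun l => a l - (A l).card) (fun _ _ => Nat.zero_le _)
        (Finset.mem_univ l)
    omega)
  omega

/-- The bound on the number of vertices, for matchings in the components of three graphs that
cover the complete graph on `U`. -/
theorem card_le_of_connectedMatchingsLE [Finite V] (m : ℕ) (n : ℕ) : ∀ U : Finset V, U.card = n →
    (∀ x ∈ U, ∀ y ∈ U, x ≠ y → ∃ l, (G l).Adj x y) → ∀ a : Fin 3 → ℕ, (∀ i, a i ≤ m) →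
    ConnectedMatchingsLE G U a → U.card ≤ ∑ i, a i + m + 1 := by
  induction n using Nat.strong_induction_on with
  | _ n ih =>
    intro U hn hcov a ham hG
    have hIH : BoundBelow G U m := fun U' hU' a' ham' hG' =>
      ih U'.card (hn ▸ Finset.card_lt_card hU') U' rfl
        (fun x hx y hy => hcov x (hU'.1 hx) y (hU'.1 hy)) a' ham' hG'
    by_cases hstar : ∃ i, ∀ x ∈ U, ∀ y ∈ U, Linked (G i) U x y
    · obtain ⟨i, hi⟩ := hstar
      exact card_le_of_linked hIH ham hG hi
    have hns : ∀ l, ∀ x ∈ U, ∃ w ∈ U, ¬ Linked (G l) U x w := by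
      intro l x hx
      by_contra! h
      exact hstar ⟨l, fun y hy y' hy' => (h y hy).symm.trans (h y' hy')⟩
    by_cases hone : ∀ x ∈ U, ∀ y ∈ U, ∀ l l', l ≠ l' → Linked (G l) U x y →
        Linked (G l') U x y → ∀ l'', Linked (G l'') U x y
    · exact card_le_of_linked_in_one_or_all hIH ham hcov hG hns hone
    push Not at hone
    obtain ⟨u, hu, v, hv, i, j, hij, hi, hj, k, hk⟩ := hone
    have hik : i ≠ k := by rintro rfl; exact hk hi
    have hjk : j ≠ k := by rintro rfl; exact hk hj
    obtain ⟨p, hmaj, hout⟩ := exists_central_classes (R := fun l => Linked (G l) U)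
      (fun _ _ _ h => h.symm) (fun _ _ _ _ h h' => h.trans h')
      (exists_linked hcov) hns hij hik hjk hu hv hi hj hk
    exact card_le_of_majority hIH ham hcov hG hmaj hout

/-! ### Connected matchings as subgraphs -/

/-- A matching given by its edge set is a matching in the sense of subgraphs. -/
lemma IsMatchingIn.card_le_connectedMatchingNumber {H : SimpleGraph V} {D : Finset V}
    {M : Finset (Sym2 V)} (hM : IsMatchingIn H D M) (hD : ∀ x ∈ D, ∀ y ∈ D, H.Reachable x y) :
    (M.card : ℕ∞) ≤ H.connectedMatchingNumber := by
  let K : H.Subgraph :=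
    { verts := ends M
      Adj := fun x y => s(x, y) ∈ M
      adj_sub := fun h => hM.mem_edgeSet _ h
      edge_vert := fun {x y} h => mem_ends.2 ⟨s(x, y), h, by simp⟩
      symm := ⟨fun x y h => by rwa [Sym2.eq_swap]⟩ }
  have hK : H.IsConnectedMatching K := by
    refine ⟨fun x hx => ?_, fun x hx y hy => hD x (hM.ends_subset hx) y (hM.ends_subset hy)⟩
    obtain ⟨e, he, hxe⟩ := mem_ends.1 hx
    obtain ⟨y, rfl⟩ := Sym2.mem_iff_exists.1 hxe
    exact ⟨y, he, fun y' hy' =>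
      (Sym2.congr_right.1 (hM.eq_of_mem _ hy' _ he x (by simp) hxe))⟩
  have hedge : K.edgeSet = M := by
    ext e
    induction e with
    | _ x y => rfl
  calc (M.card : ℕ∞) = K.edgeSet.encard := by rw [hedge, Set.encard_coe_eq_coe_finsetCard]
    _ ≤ _ := le_iSup (fun M : {M : H.Subgraph // H.IsConnectedMatching M} => M.1.edgeSet.encard)
      ⟨K, hK⟩

end ConnectedMatchingRamsey

theorem mainTheorem2 {V : Type*} [Fintype V] (x₁ x₂ x₃ : ℕ)
    (h₂ : 1 ≤ x₂) (h₃ : 1 ≤ x₃) (h₂₁ : x₂ ≤ x₁) (h₃₁ : x₃ ≤ x₁)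
    (hN : Fintype.card V = 2 * x₁ + x₂ + x₃ - 2)
    (C : SimpleGraph.TopEdgeLabeling V (Fin 3)) :
    (x₁ : ℕ∞) ≤ (C.labelGraph 0).connectedMatchingNumber ∨
    (x₂ : ℕ∞) ≤ (C.labelGraph 1).connectedMatchingNumber ∨
    (x₃ : ℕ∞) ≤ (C.labelGraph 2).connectedMatchingNumber := by
  classical
  by_contra! h
  have hlt : ∀ l, ((C.labelGraph l).connectedMatchingNumber) < ((![x₁, x₂, x₃] l : ℕ) : ℕ∞) := by
    intro l
    fin_cases l
    exacts [h.1, h.2.1, h.2.2]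
  -- Each `xᵢ` is positive, so the truncated differences `xᵢ - 1` bound the connected matchings.
  have hcard := ConnectedMatchingRamsey.card_le_of_connectedMatchingsLE
    (G := fun l => C.labelGraph l) (x₁ - 1) _ Finset.univ rfl
    (fun x _ y _ hxy => ⟨C.get x y hxy,
      (SimpleGraph.TopEdgeLabeling.labelGraph_adj x y).2 ⟨hxy, rfl⟩⟩)
    (fun l => ![x₁, x₂, x₃] l - 1)
    (fun l => by fin_cases l <;> simp <;> omega)
    (fun l D _ hD M hM => by
      have := (hM.card_le_connectedMatchingNumber fun x hx y hy =>
        (hD x hx y hy).reachable).trans_lt (hlt l)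
      have : M.card < ![x₁, x₂, x₃] l := by exact_mod_cast this
      exact Nat.le_sub_one_of_lt this)
  rw [Finset.card_univ, hN] at hcard
  simp [Fin.sum_univ_three] at hcard
  omega
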